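/- For $N\ge 0$ let $E^{(N)}=\{\{0,1,2\},\{1,2,3\},\dots,\{N-3,N-2,N-1\}\}$ be the chain hypergraph on $\{0,\dots,N-1\}$ (empty for $N\le 2$), and let $|\psi_N\rangle=\prod_{\{i,j,k\}\in E^{(N)}}CCZ_{i,j,k}\,|+\rangle^{\otimes N}$ be its hypergraph state. The Pauli–Liouville (PL) moment of an $N$-qubit state $|\psi\rangle$ is $$m_\alpha(\psi)=\frac1{2^N}\sum_{x,z\in\{0,1\}^N}\bigl|\langle\psi|P^{x,z}|\psi\rangle\bigr|^{2\alpha},\qquad P^{x,z}=\sqrt{-1}^{\,x\cdot z}X^xZ^z .$$ For $x\in GF(2)^N$ let $C(x)$ be the strictly upper triangular $GF(2)$ matrix with $C_{i,j}(x)=\sum_{k:\{i,j,k\}\in E^{(N)}}x_k$ for $i<j$, and let $2h(x)$ be the rank over $GF(2)$ of $C(x)+C(x)^T$. For real $\alpha$, $A\subseteq\{0,\dots,N-1\}$ and prescribed bits $y_i$ ($i\in A$), the partially fixed PL moment is $$m^{(N)}_{\alpha,(x_i=y_i)_{i\in A}}=\frac1{2^{N-|A|}}\sum_{x:\;x_i=y_i\,(i\in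 A)}2^{(1-\alpha)2h(x)} .$$ Write $m^{(N)}_\alpha$ for $A=\emptyset$, $m^{(N)}_{\alpha,(y_0)}$ for $x_0=y_0$ fixed ($N\ge1$), and $m^{(N)}_{\alpha,(y_0,y_1)}$ for $x_0=y_0$, $x_1=y_1$ fixed ($N\ge2$). Put $\beta=2^{2(1-\alpha)}$. Then, for every real $\alpha$: 1. For all $N\ge4$, $$m^{(N)}_{\alpha,(0,0)}=\tfrac14m^{(N-2)}_{\alpha,(0,0)}+\tfrac\beta2m^{(N-2)}_{\alpha,(1)}+\tfrac\beta4m^{(N-3)}_{\alpha,(1)},$$ $$m^{(N)}_{\alpha,(1)}=\tfrac\beta2m^{(N-2)}_{\alpha,(1)}+\tfrac18m^{(N-2)}_{\alpha,(0,1)}+\tfrac\beta4m^{(N-3)}_{\alpha,(0)}+\tfrac\beta8m^{(N-3)}_{\alpha,(1)},$$ $$m^{(N)}_{\alpha,(0,1)}=\tfrac\beta2m^{(N-2)}_{\alpha,(1)}+\tfrac\beta2m^{(N-3)}_{\alpha}.$$ 2. Let $$A=\begin{pmatrix}\frac14&0&\frac\beta2\\0&0&\frac\beta2\\0&\frac18&\frac\beta2\end{pmatrix},\quad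 B=\begin{pmatrix}0&\frac\beta4\\\frac\beta4&\frac\beta4\\\frac\beta4&\frac\beta8\end{pmatrix},\quad C=\begin{pmatrix}\frac12&\frac12&0\\0&0&1\end{pmatrix},\quad \mathcal A=\begin{pmatrix}0&A&B\\I_3&0&0\\0&C&0\end{pmatrix},$$ let $v_N=(m^{(N)}_{\alpha,(0,0)},m^{(N)}_{\alpha,(0,1)},m^{(N)}_{\alpha,(1)})^T$, $w_N=(m^{(N)}_{\alpha,(0)},m^{(N)}_{\alpha,(1)})^T$, and let $\mathcal M_N=(v_N,v_{N-1},w_{N-2})^T\in\mathbb R^8$ for $N\ge3$. For all $N\ge4$, $v_N=Av_{N-2}+Bw_{N-3}$ and $\mathcal M_N=\mathcal A\,\mathcal M_{N-1}$. 3. The initial values are $m^{(3)}_{\alpha,(0,0)}=\frac{1+\beta}2$, $m^{(3)}_{\alpha,(0,1)}=m^{(3)}_{\alpha,(1)}=\beta$; $m^{(4)}_{\alpha,(0,0)}=\frac{1+3\beta}4$, $m^{(4)}_{\alpha,(0,1)}=\beta$, $m^{(4)}_{\alpha,(1)}=\frac{1+7\beta}8$; and $m^{(2)}_{\alpha,(y_0,y_1)}=m^{(2)}_{\alpha,(y_0)}=m^{(1)}_{\alpha,(y_0)}=1$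 for all bits $y_0,y_1$. 4. For all $N\ge2$, $m^{(N)}_\alpha=\frac14\bigl(m^{(N)}_{\alpha,(0,0)}+m^{(N)}_{\alpha,(0,1)}\bigr)+\frac12m^{(N)}_{\alpha,(1)}$. 5. For all $N\ge3$, $\mathcal M_N=\mathcal A^{N-3}\mathcal M_3$ with $\mathcal M_3=\bigl(\frac{1+\beta}2,\beta,\beta,1,1,1,1,1\bigr)^T$. 6. If $\alpha>0$, then $m_\alpha(\psi_N)=m^{(N)}_\alpha$ for all $N\ge 0$. Consequently $m_\alpha(\psi_N)=1$ for $N\le2$, and for all $N\ge3$ the PL moment is given exactly by $m_\alpha(\psi_N)=\frac14(u_1+u_2)+\frac12u_3$, where $u=\mathcal A^{N-3}\bigl(\frac{1+\beta}2,\beta,\beta,1,1,1,1,1\bigr)^T$. -/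

import Mathlib

open scoped Matrix

noncomputable section

namespace Hypergraph

/-- Bit strings of length `N`; they label the computational basis of `N` qubits. -/
abbrev Bits (N : ℕ) : Type := Fin N → ZMod 2

/-- A pure state vector of `N` qubits, given by its amplitudes in the computational basis. -/
abbrev StateVec (N : ℕ) : Type := Bits N → ℂ

/-- The single-qubit Pauli matrix `X`. -/
def pauliX : Matrix (ZMod 2) (ZMod 2) ℂ := Matrix.of fun b a => if b = a + 1 then 1 else 0

/-- The single-qubit Pauli matrix `Z`. -/
def pauliZ : Matrix (ZMod 2) (ZMod 2) ℂ := Matrix.diagonal fun a => if a = 1 then -1 else 1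

/-- The single-qubit operator `√-1 ^ (x z) X ^ x Z ^ z`. -/
def pauliOne (x z : ZMod 2) : Matrix (ZMod 2) (ZMod 2) ℂ :=
  (Complex.I ^ (x.val * z.val)) • (pauliX ^ x.val * pauliZ ^ z.val)

/-- The Pauli string `P^{x,z} = √-1 ^ (x · z) X^x Z^z`, as the tensor product of its single-qubit
factors. -/
def pauliString {N : ℕ} (x z : Bits N) : Matrix (Bits N) (Bits N) ℂ :=
  Matrix.of fun b a => ∏ i, pauliOne (x i) (z i) (b i) (a i)

/-- The Pauli-Liouville moment
`m_α = 2^{-N} ∑_{x,z} |⟨ψ| P^{x,z} |ψ⟩|^{2α}` of a state `ψ`. -/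
def plMoment {N : ℕ} (α : ℝ) (ψ : StateVec N) : ℝ :=
  (1 / 2 ^ N) * ∑ x : Bits N, ∑ z : Bits N, ‖star ψ ⬝ᵥ (pauliString x z *ᵥ ψ)‖ ^ (2 * α)

/-- The state `|+⟩^{⊗ N}`. -/
def plusState (N : ℕ) : StateVec N := fun _ => ((1 / Real.sqrt 2 : ℝ) : ℂ) ^ N

/-- The multiply controlled `Z` gate on the qubits in `e`: the identity minus twice the projection
on the basis states that have a `1` at every qubit of `e`. For `|e| = 3` this is `CCZ`. -/
def controlledZ {N : ℕ} (e : Finset (Fin N)) : Matrix (Bits N) (Bits N) ℂ :=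
  1 - (2 : ℂ) • Matrix.diagonal fun a => if ∀ i ∈ e, a i = 1 then 1 else 0

theorem controlledZ_commute {N : ℕ} (e f : Finset (Fin N)) :
    Commute (controlledZ e) (controlledZ f) := by
  unfold controlledZ
  have h := (Matrix.commute_diagonal (fun a : Bits N => if ∀ i ∈ e, a i = 1 then (1 : ℂ) else 0)
    (fun a : Bits N => if ∀ i ∈ f, a i = 1 then (1 : ℂ) else 0))
  exact ((Commute.one_left _).sub_left
    (((Commute.one_right _).sub_right ((h.smul_left _).smul_right _))))

/-- The hypergraph state `∏_{e ∈ E} CZ_e |+⟩^{⊗ N}` of a set `E` of hyperedges. -/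
def hypergraphState {N : ℕ} (E : Finset (Finset (Fin N))) : StateVec N :=
  (E.noncommProd controlledZ fun e _ f _ _ => controlledZ_commute e f) *ᵥ plusState N

/-- The strictly upper triangular matrix `C_{i,j}(x) = ∑_{k : {i,j,k} ∈ E} x_k` (`i < j`) over
`GF(2)` of a 3-uniform hypergraph. -/
def cMatrix {N : ℕ} (E : Finset (Finset (Fin N))) (x : Bits N) :
    Matrix (Fin N) (Fin N) (ZMod 2) :=
  Matrix.of fun i j => if i < j then ∑ k with ({i, j, k} : Finset (Fin N)) ∈ E, x k else 0

/-- The rank `2h(x)` of the symmetric `GF(2)` matrix `C(x) + C(x)ᵀ`. -/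
def twoH {N : ℕ} (E : Finset (Finset (Fin N))) (x : Bits N) : ℕ :=
  (cMatrix E x + (cMatrix E x)ᵀ).rank

/-- The moment with fixed values `x_i = y_i` for `i ∈ A`:
`2^{-(N-|A|)} ∑_{x, x_i = y_i (i ∈ A)} 2^{(1-α) 2h(x)}`. -/
def fixedMoment {N : ℕ} (α : ℝ) (E : Finset (Finset (Fin N))) (A : Finset (Fin N))
    (y : Bits N) : ℝ :=
  (1 / 2 ^ (N - A.card)) *
    ∑ x : Bits N with ∀ i ∈ A, x i = y i, (2 : ℝ) ^ ((1 - α) * (twoH E x : ℝ))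

/-- The hyperedges `{0,1,2}, {1,2,3}, …, {N-3,N-2,N-1}` of the chain on `N` vertices. -/
def chain (N : ℕ) : Finset (Finset (Fin N)) :=
  Finset.univ.filter fun e => ∃ i j k : Fin N,
    (j : ℕ) = i + 1 ∧ (k : ℕ) = i + 2 ∧ e = {i, j, k}

/-- `m α N [y₀, …, y_{l-1}]` is the moment `m^{(N)}_{α,(y₀,…,y_{l-1})}` of the chain on `N` qubits
with the first `l` bits of `x` fixed (used for `l ≤ N`); `m α N []` has no bit fixed. -/
def m (α : ℝ) (N : ℕ) (y : List (ZMod 2)) : ℝ :=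
  fixedMoment α (chain N) {i | (i : ℕ) < y.length} fun i => y.getD i 0

/-- The Pauli-Liouville moment of the hypergraph state of the chain on `N` qubits. -/
def chainPL (α : ℝ) (N : ℕ) : ℝ := plMoment α (hypergraphState (chain N))

/-- `β = 2^{2(1-α)}`. -/
def β (α : ℝ) : ℝ := (2 : ℝ) ^ (2 * (1 - α))

def matA (α : ℝ) : Matrix (Fin 3) (Fin 3) ℝ :=
  !![1 / 4, 0, β α / 2;
     0, 0, β α / 2;
     0, 1 / 8, β α / 2]

def matB (α : ℝ) : Matrix (Fin 3) (Fin 2) ℝ :=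
  !![0, β α / 4;
     β α / 4, β α / 4;
     β α / 4, β α / 8]

def matC : Matrix (Fin 2) (Fin 3) ℝ :=
  !![1 / 2, 1 / 2, 0;
     0, 0, 1]

/-- Index set of the eight components, in three blocks of sizes 3, 3, 2. -/
abbrev Idx : Type := Fin 3 ⊕ (Fin 3 ⊕ Fin 2)

/-- The block matrix with rows `(0, A, B)`, `(I, 0, 0)`, `(0, C, 0)`. -/
def transfer (α : ℝ) : Matrix Idx Idx ℝ :=
  Matrix.fromBlocks 0 (Matrix.fromCols (matA α) (matB α))
    (Matrix.fromRows 1 0) (Matrix.fromBlocks 0 0 matC 0)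

/-- The vector `(m_{(0,0)}, m_{(0,1)}, m_{(1)})` at size `N`. -/
def vec3 (α : ℝ) (N : ℕ) : Fin 3 → ℝ := ![m α N [0, 0], m α N [0, 1], m α N [1]]

/-- The vector `(m_{(0)}, m_{(1)})` at size `N`. -/
def vec2 (α : ℝ) (N : ℕ) : Fin 2 → ℝ := ![m α N [0], m α N [1]]

/-- The vector `𝓜_N` (used for `3 ≤ N`). -/
def vecM (α : ℝ) (N : ℕ) : Idx → ℝ :=
  Sum.elim (vec3 α N) (Sum.elim (vec3 α (N - 1)) (vec2 α (N - 2)))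

/-- The explicit initial vector of the matrix recursion. -/
def initM (α : ℝ) : Idx → ℝ :=
  Sum.elim ![(1 + β α) / 2, β α, β α] (Sum.elim ![1, 1, 1] ![1, 1])

/-- The linear functional `(v_{(0,0)} + v_{(0,1)}) / 4 + v_{(1)} / 2` of the first block. -/
def total (v : Idx → ℝ) : ℝ := (v (.inl 0) + v (.inl 1)) / 4 + v (.inl 2) / 2

end Hypergraph

end

/-!
The expectation of `P^{x,z}` in a hypergraph state is, up to a phase, a Fourier coefficient of the
sign of the derivative `a ↦ f(a) + f(a + x)` of the cubic phase `f`. This derivative is quadratic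
with polar form `C(x) + C(x)ᵀ`, so its Fourier transform has constant modulus on its support; with
Parseval this evaluates the sum over `z` to `2 ^ ((1 - α) * 2h(x))`.

For the chain, `C(x) + C(x)ᵀ` is banded: row `i` involves only positions `i - 2, …, i + 2`. Once
the first few bits of `x` are fixed, the first few rows can be solved explicitly, and what remains
is the kernel for a shorter chain. Counting kernel vectors compares the ranks, and averaging over
the fixed bits turns the comparison into the recursion.
-/

noncomputable section

namespace PauliLiouville

open Hypergraph
open Matrix (vecCons)
open scoped ComplexConjugate

section Fourier

variable {G : Type*} [AddCommGroup G]

theorem sq_norm_sum_eq_sum_autocorrelation [Fintype G] (f : G → ℂ) :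
    ((‖∑ a, f a‖ ^ 2 : ℝ) : ℂ) = ∑ b, ∑ a, conj (f a) * f (a + b) := by
  rw [Complex.ofReal_pow, ← Complex.conj_mul', map_sum, Finset.sum_mul_sum,
    eq_comm, Finset.sum_comm]
  exact Finset.sum_congr rfl fun a _ =>
    Equiv.sum_comp (Equiv.addLeft a) fun b => conj (f a) * f b

theorem conj_mul_addChar_add [Finite G] (ψ : AddChar G ℂ) (a b : G) :
    conj (ψ a) * ψ (a + b) = ψ b := by
  rw [AddChar.map_add_eq_mul, ← mul_assoc, Complex.conj_mul', AddChar.norm_apply]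
  simp

theorem sum_sq_norm_sum_mul_addChar [Fintype G] (f : G → ℂ) :
    ∑ ψ : AddChar G ℂ, ‖∑ a, f a * ψ a‖ ^ 2 = Fintype.card G * ∑ a, ‖f a‖ ^ 2 := by
  classical
  have expand (ψ : AddChar G ℂ) : ((‖∑ a, f a * ψ a‖ ^ 2 : ℝ) : ℂ) =
      ∑ b, (∑ a, conj (f a) * f (a + b)) * ψ b := by
    rw [sq_norm_sum_eq_sum_autocorrelation]
    simp only [Finset.sum_mul]
    refine Finset.sum_congr rfl fun b _ => Finset.sum_congr rfl fun a _ => ?_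
    rw [map_mul, ← conj_mul_addChar_add ψ a b]
    ring
  apply Complex.ofReal_injective
  rw [Complex.ofReal_sum]
  simp only [expand]
  rw [Finset.sum_comm]
  simp only [← Finset.mul_sum, AddChar.sum_apply_eq_ite, mul_ite, mul_zero, Finset.sum_ite_eq',
    Finset.mem_univ, if_true, add_zero, Complex.conj_mul']
  push_cast
  ring

/-- A function with values on the unit circle whose multiplicative second difference is the
bicharacter `(a, b) ↦ B b a`; the model is `a ↦ χ (q a)` for an additive character `χ` and a
quadratic function `q` with polarization `B`. -/
structure IsQuadraticPhase (f : G → ℂ) (B : G →+ AddChar G ℂ) : Prop where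
  norm_apply : ∀ a, ‖f a‖ = 1
  map_add_mul_map_zero : ∀ a b, f (a + b) * f 0 = f a * f b * B b a

namespace IsQuadraticPhase

variable {f : G → ℂ} {B : G →+ AddChar G ℂ}

theorem ne_zero (hf : IsQuadraticPhase f B) (a : G) : f a ≠ 0 :=
  norm_ne_zero_iff.mp (by simp [hf.norm_apply])

theorem mul_addChar [Finite G] (hf : IsQuadraticPhase f B) (ψ : AddChar G ℂ) :
    IsQuadraticPhase (fun a => f a * ψ a) B where
  norm_apply a := by simp [hf.norm_apply, AddChar.norm_apply]
  map_add_mul_map_zero a b := by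
    simp only [AddChar.map_add_eq_mul, AddChar.map_zero_eq_one]
    linear_combination ψ a * ψ b * hf.map_add_mul_map_zero a b

/-- On the kernel of its polarization a quadratic phase is, up to its value at `0`, a character. -/
def kerChar (hf : IsQuadraticPhase f B) : AddChar B.ker ℂ where
  toFun b := f b / f 0
  map_zero_eq_one' := div_self (hf.ne_zero 0)
  map_add_eq_mul' a b := by
    have h := hf.map_add_mul_map_zero a b
    rw [B.mem_ker.mp b.2, AddChar.zero_apply] at h
    have := hf.ne_zero 0
    push_cast
    field_simp
    linear_combination h

theorem conj_mul_add (hf : IsQuadraticPhase f B) (a b : G) :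
    conj (f a) * f (a + b) = f b / f 0 * B b a := by
  have unit : conj (f a) * f a = 1 := by simp [Complex.conj_mul', hf.norm_apply]
  have := hf.ne_zero 0
  field_simp
  linear_combination conj (f a) * hf.map_add_mul_map_zero a b + f b * B b a * unit

theorem sq_norm_sum [Fintype G] [Fintype B.ker] (hf : IsQuadraticPhase f B) :
    ((‖∑ a, f a‖ ^ 2 : ℝ) : ℂ) = Fintype.card G * ∑ b, hf.kerChar b := by
  classical
  have orthogonality (b : G) : ∑ a, B b a = if b ∈ B.ker then (Fintype.card G : ℂ) else 0 := by
    simp only [AddChar.sum_eq_ite, B.mem_ker]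
  simp only [sq_norm_sum_eq_sum_autocorrelation, hf.conj_mul_add, ← Finset.mul_sum, orthogonality,
    mul_ite, mul_zero]
  rw [← Finset.sum_filter, Finset.sum_subtype (p := (· ∈ B.ker)) _ (by simp), Finset.mul_sum]
  exact Finset.sum_congr rfl fun b _ => mul_comm _ _

theorem sq_norm_sum_eq_zero_or [Fintype G] (hf : IsQuadraticPhase f B) :
    ‖∑ a, f a‖ ^ 2 = 0 ∨ ‖∑ a, f a‖ ^ 2 = Fintype.card G * Nat.card B.ker := by
  classical
  have h := hf.sq_norm_sum
  rw [AddChar.sum_eq_ite] at h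
  split_ifs at h
  · right
    rw [Nat.card_eq_fintype_card]
    exact_mod_cast h
  · left
    rw [mul_zero] at h
    exact_mod_cast h

end IsQuadraticPhase

theorem sum_rpow_eq_of_forall_eq_zero_or {ι : Type*} [Fintype ι] {t : ι → ℝ} {c α : ℝ}
    (hc : 0 < c) (hα : 0 < α) (ht : ∀ i, t i = 0 ∨ t i = c) :
    ∑ i, t i ^ α = c ^ (α - 1) * ∑ i, t i := by
  rw [Finset.mul_sum]
  refine Finset.sum_congr rfl fun i _ => ?_
  rcases ht i with h | h <;> rw [h]
  · rw [Real.zero_rpow hα.ne', mul_zero]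
  · rw [Real.rpow_sub_one hc.ne', div_mul_cancel₀ _ hc.ne']

/-- The normalized Fourier coefficients of a quadratic phase have squared modulus `0` or
`|ker B| / |G|`, so Parseval's identity counts the nonzero ones. -/
theorem IsQuadraticPhase.sum_rpow_norm_sum_mul_addChar [Fintype G] {f : G → ℂ}
    {B : G →+ AddChar G ℂ} (hf : IsQuadraticPhase f B) {α : ℝ} (hα : 0 < α) :
    ∑ ψ : AddChar G ℂ, (‖∑ a, f a * ψ a‖ / Fintype.card G) ^ (2 * α) =
      (Fintype.card G / Nat.card B.ker : ℝ) ^ (1 - α) := by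
  have hG : (0 : ℝ) < Fintype.card G := by exact_mod_cast Fintype.card_pos
  have hker : (0 : ℝ) < Nat.card B.ker := by exact_mod_cast Nat.card_pos
  have flat (ψ : AddChar G ℂ) : (‖∑ a, f a * ψ a‖ / Fintype.card G : ℝ) ^ 2 = 0 ∨
      (‖∑ a, f a * ψ a‖ / Fintype.card G : ℝ) ^ 2 = Nat.card B.ker / Fintype.card G := by
    rw [div_pow]
    rcases (hf.mul_addChar ψ).sq_norm_sum_eq_zero_or with h | h <;> rw [h]
    · simp
    · right; field_simp
  have parseval : ∑ ψ : AddChar G ℂ, (‖∑ a, f a * ψ a‖ / Fintype.card G : ℝ) ^ 2 = 1 := by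
    simp only [div_pow, ← Finset.sum_div, sum_sq_norm_sum_mul_addChar, hf.norm_apply]
    simp
    field_simp
  simp only [Real.rpow_mul (div_nonneg (norm_nonneg _) hG.le), Real.rpow_two]
  rw [sum_rpow_eq_of_forall_eq_zero_or (by positivity) hα flat, parseval, mul_one,
    ← neg_sub α 1, Real.rpow_neg (by positivity), ← Real.inv_rpow (by positivity), inv_div]

end Fourier

section DotProductCharacters

variable {ι R : Type*} [Fintype ι] [CommRing R]

/-- The character `a ↦ χ (z · a)` of the coordinate space, for an additive character `χ` of the
coefficient ring. -/
def dotChar (χ : AddChar R ℂ) : (ι → R) →+ AddChar (ι → R) ℂ where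
  toFun z :=
    { toFun a := χ (z ⬝ᵥ a)
      map_zero_eq_one' := by rw [dotProduct_zero, AddChar.map_zero_eq_one]
      map_add_eq_mul' a b := by rw [dotProduct_add, AddChar.map_add_eq_mul] }
  map_zero' := by ext a; simp
  map_add' z w := by ext a; simp [add_dotProduct, AddChar.map_add_eq_mul]

@[simp]
theorem dotChar_apply (χ : AddChar R ℂ) (z a : ι → R) : dotChar χ z a = χ (z ⬝ᵥ a) := rfl

theorem dotChar_injective {χ : AddChar R ℂ} (hχ : χ.IsPrimitive) :
    Function.Injective (dotChar χ : (ι → R) →+ AddChar (ι → R) ℂ) := by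
  classical
  rw [injective_iff_map_eq_zero]
  intro z hz
  by_contra hne
  obtain ⟨i, hi⟩ := Function.ne_iff.mp hne
  refine hχ hi (DFunLike.ext _ _ fun r => ?_)
  simpa using DFunLike.congr_fun hz (Pi.single i r)

theorem dotChar_bijective [Finite R] {χ : AddChar R ℂ} (hχ : χ.IsPrimitive) :
    Function.Bijective (dotChar χ : (ι → R) →+ AddChar (ι → R) ℂ) := by
  classical
  have := Fintype.ofFinite R
  exact (Fintype.bijective_iff_injective_and_card _).mpr
    ⟨dotChar_injective hχ, AddChar.card_eq.symm⟩

end DotProductCharacters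

theorem card_pow_rank_mul_card_ker {K m n : Type*} [Field K] [Finite K] [Fintype n]
    (M : Matrix m n K) :
    Nat.card K ^ M.rank * Nat.card M.mulVecLin.ker = Nat.card K ^ Fintype.card n := by
  rw [Module.natCard_eq_pow_finrank (K := K) (V := M.mulVecLin.ker), ← pow_add, Matrix.rank,
    LinearMap.finrank_range_add_finrank_ker, Module.finrank_fintype_fun_eq_card]

theorem sum_rpow_norm_sum_mul_dotChar {ι K : Type*} [Fintype ι] [DecidableEq ι] [Field K]
    [Fintype K] {χ : AddChar K ℂ} (hχ : χ.IsPrimitive) {M : Matrix ι ι K} {f : (ι → K) → ℂ}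
    (hf : IsQuadraticPhase f ((dotChar χ).comp M.mulVecLin.toAddMonoidHom)) {α : ℝ} (hα : 0 < α) :
    ∑ z : ι → K, (‖∑ a, f a * χ (z ⬝ᵥ a)‖ / Fintype.card (ι → K)) ^ (2 * α) =
      (Fintype.card K : ℝ) ^ ((1 - α) * M.rank) := by
  have ker_eq : ((dotChar χ).comp M.mulVecLin.toAddMonoidHom).ker =
      M.mulVecLin.ker.toAddSubgroup := by
    ext b
    exact map_eq_zero_iff _ (dotChar_injective hχ)
  have count : (Fintype.card K : ℝ) ^ M.rank * Nat.card M.mulVecLin.ker =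
      Fintype.card (ι → K) := by
    rw [Fintype.card_fun, ← Nat.card_eq_fintype_card (α := K)]
    exact_mod_cast card_pow_rank_mul_card_ker M
  have hker : (Nat.card M.mulVecLin.ker : ℝ) ≠ 0 := by exact_mod_cast Nat.card_pos.ne'
  calc ∑ z : ι → K, (‖∑ a, f a * χ (z ⬝ᵥ a)‖ / Fintype.card (ι → K)) ^ (2 * α)
      = ∑ ψ : AddChar (ι → K) ℂ, (‖∑ a, f a * ψ a‖ / Fintype.card (ι → K)) ^ (2 * α) :=
        (dotChar_bijective hχ).sum_comp fun ψ =>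
          (‖∑ a, f a * ψ a‖ / (Fintype.card (ι → K) : ℝ)) ^ (2 * α)
    _ = (Fintype.card (ι → K) / Nat.card M.mulVecLin.ker : ℝ) ^ (1 - α) := by
        rw [hf.sum_rpow_norm_sum_mul_addChar hα, ker_eq]
        rfl
    _ = (Fintype.card K : ℝ) ^ ((1 - α) * M.rank) := by
        rw [← count, mul_div_cancel_right₀ _ hker, mul_comm (1 - α), Real.rpow_mul (by positivity),
          Real.rpow_natCast]

section HypergraphStates

theorem addChar_sum_eq_prod {ι A M : Type*} [AddCommMonoid A] [CommMonoid M] (ψ : AddChar A M)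
    (s : Finset ι) (f : ι → A) : ψ (∑ i ∈ s, f i) = ∏ i ∈ s, ψ (f i) :=
  map_prod ψ.toMonoidHom (fun i => Multiplicative.ofAdd (f i)) s

/-- The nontrivial character `a ↦ (-1) ^ a` of `GF(2)`. -/
def signChar : AddChar (ZMod 2) ℂ := AddChar.zmodChar 2 (neg_one_sq (R := ℂ))

@[simp]
theorem signChar_one : signChar 1 = -1 := by
  simp [signChar, AddChar.zmodChar_apply, ZMod.val_one]

theorem signChar_isPrimitive : signChar.IsPrimitive :=
  AddChar.zmodChar_primitive_of_primitive_root 2 (IsPrimitiveRoot.neg_one 0 two_ne_zero.symm)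

theorem zmod_two_cases (a : ZMod 2) : a = 0 ∨ a = 1 := by
  revert a; decide

theorem signChar_eq_ite (a : ZMod 2) : signChar a = if a = 1 then -1 else 1 := by
  rcases zmod_two_cases a with rfl | rfl <;> simp

theorem conj_signChar (a : ZMod 2) : conj (signChar a) = signChar a := by
  rw [signChar_eq_ite]; split_ifs <;> simp

theorem isQuadraticPhase_signChar {N : ℕ} {q : Bits N → ZMod 2}
    {M : Matrix (Fin N) (Fin N) (ZMod 2)}
    (hq : ∀ a b, q (a + b) + q 0 = q a + q b + (M *ᵥ b) ⬝ᵥ a) :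
    IsQuadraticPhase (fun a => signChar (q a))
      ((dotChar signChar).comp M.mulVecLin.toAddMonoidHom) where
  norm_apply a := AddChar.norm_apply signChar _
  map_add_mul_map_zero a b := by
    rw [← AddChar.map_add_eq_mul, hq, AddChar.map_add_eq_mul, AddChar.map_add_eq_mul]
    rfl

/-- The polynomial function `∑_{e ∈ E} ∏_{i ∈ e} a_i` of a hypergraph; its sign is the phase of the
hypergraph state. -/
def edgeForm {N : ℕ} (E : Finset (Finset (Fin N))) (a : Bits N) : ZMod 2 := ∑ e ∈ E, ∏ i ∈ e, a i

theorem controlledZ_eq_diagonal {N : ℕ} (e : Finset (Fin N)) :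
    controlledZ e = Matrix.diagonal fun a : Bits N => signChar (∏ i ∈ e, a i) := by
  have prod_eq_one_iff (a : Bits N) : (∀ i ∈ e, a i = 1) ↔ ∏ i ∈ e, a i = 1 := by
    refine ⟨Finset.prod_eq_one, fun h i hi => (zmod_two_cases _).resolve_left fun h0 => ?_⟩
    exact zero_ne_one (Finset.prod_eq_zero hi h0 ▸ h)
  rw [controlledZ, ← Matrix.diagonal_one, ← Matrix.diagonal_smul, Matrix.diagonal_sub]
  congr 1
  funext a
  simp only [prod_eq_one_iff, signChar_eq_ite, Pi.smul_apply, smul_eq_mul]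
  split_ifs <;> norm_num

theorem noncommProd_controlledZ {N : ℕ} (E : Finset (Finset (Fin N)))
    (comm : (E : Set (Finset (Fin N))).Pairwise (Function.onFun Commute controlledZ)) :
    E.noncommProd controlledZ comm = Matrix.diagonal fun a => signChar (edgeForm E a) := by
  induction E using Finset.induction_on with
  | empty => simp [edgeForm]
  | insert e s he ih =>
    rw [Finset.noncommProd_insert_of_notMem _ _ _ _ he, ih, controlledZ_eq_diagonal,
      Matrix.diagonal_mul_diagonal]
    simp only [edgeForm, Finset.sum_insert he, AddChar.map_add_eq_mul]

theorem hypergraphState_apply {N : ℕ} (E : Finset (Finset (Fin N))) (a : Bits N) :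
    hypergraphState E a = signChar (edgeForm E a) * ((1 / √2 : ℝ) : ℂ) ^ N := by
  have eq_diagonal : hypergraphState E =
      (Matrix.diagonal fun a => signChar (edgeForm E a)) *ᵥ plusState N :=
    congrArg (· *ᵥ plusState N) (noncommProd_controlledZ E _)
  rw [eq_diagonal, Matrix.mulVec_diagonal, plusState]

theorem pauliOne_apply (x z b a : ZMod 2) :
    pauliOne x z b a =
      Complex.I ^ (x.val * z.val) * if b = a + x then signChar (z * a) else 0 := by
  rcases zmod_two_cases x with rfl | rfl <;> rcases zmod_two_cases z with rfl | rfl <;>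
    rcases zmod_two_cases b with rfl | rfl <;> rcases zmod_two_cases a with rfl | rfl <;>
    simp [pauliOne, pauliX, pauliZ, ZMod.val_one, CharTwo.add_self_eq_zero]

theorem pauliString_apply {N : ℕ} (x z b a : Bits N) :
    pauliString x z b a = Complex.I ^ (∑ i, (x i).val * (z i).val) *
      if b = a + x then signChar (z ⬝ᵥ a) else 0 := by
  simp only [pauliString, Matrix.of_apply, pauliOne_apply, Finset.prod_mul_distrib,
    Finset.prod_pow_eq_pow_sum]
  congr 1
  split_ifs with h
  · simp [h, dotProduct, addChar_sum_eq_prod]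
  · obtain ⟨i, hi⟩ := Function.ne_iff.mp h
    exact Finset.prod_eq_zero (Finset.mem_univ i) (if_neg hi)

theorem pauliString_expectation {N : ℕ} (x z : Bits N) (ψ : StateVec N) :
    star ψ ⬝ᵥ (pauliString x z *ᵥ ψ) = Complex.I ^ (∑ i, (x i).val * (z i).val) *
      ∑ a, conj (ψ (a + x)) * ψ a * signChar (z ⬝ᵥ a) := by
  simp only [dotProduct, Matrix.mulVec, Finset.mul_sum]
  rw [Finset.sum_comm]
  refine Finset.sum_congr rfl fun a _ => ?_
  rw [Finset.sum_eq_single (a + x) (fun b _ hb => by simp [pauliString_apply, hb]) (by simp),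
    pauliString_apply, if_pos rfl, Pi.star_apply, Complex.star_def, dotProduct]
  ring

theorem norm_hypergraphState_expectation {N : ℕ} (E : Finset (Finset (Fin N))) (x z : Bits N) :
    ‖star (hypergraphState E) ⬝ᵥ (pauliString x z *ᵥ hypergraphState E)‖ =
      ‖∑ a, signChar (edgeForm E (a + x) + edgeForm E a) * signChar (z ⬝ᵥ a)‖ /
        Fintype.card (Bits N) := by
  have amplitude_sq : ((1 / √2 : ℝ) : ℂ) ^ N * ((1 / √2 : ℝ) : ℂ) ^ N = 1 / 2 ^ N := by
    rw [← mul_pow, ← Complex.ofReal_mul, div_mul_div_comm, Real.mul_self_sqrt zero_le_two]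
    simp
  have term (a : Bits N) : conj (hypergraphState E (a + x)) * hypergraphState E a =
      1 / 2 ^ N * signChar (edgeForm E (a + x) + edgeForm E a) := by
    rw [hypergraphState_apply, hypergraphState_apply, map_mul, conj_signChar, map_pow,
      Complex.conj_ofReal, AddChar.map_add_eq_mul, ← amplitude_sq]
    ring
  simp only [pauliString_expectation, term, mul_assoc, ← Finset.mul_sum]
  simp [div_eq_inv_mul]

theorem triple_eq_triple_iff {ι : Type*} [DecidableEq ι] {p q r : ι} (hpq : p ≠ q) (hpr : p ≠ r)
    (hqr : q ≠ r) (i j k : ι) :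
    ({i, j, k} : Finset ι) = {p, q, r} ↔ (i, j, k) ∈
      ({(p, q, r), (p, r, q), (q, p, r), (q, r, p), (r, p, q), (r, q, p)} :
        Finset (ι × ι × ι)) := by
  simp only [Finset.ext_iff, Finset.mem_insert, Finset.mem_singleton, Prod.mk.injEq]
  constructor
  · intro h
    have := h i; have := h j; have := h k; have := h p; have := h q; have := h r
    grind
  · grind

theorem sum_triples_eq_triple {ι R : Type*} [Fintype ι] [DecidableEq ι] [AddCommMonoid R]
    {p q r : ι} (hpq : p ≠ q) (hpr : p ≠ r) (hqr : q ≠ r) (F : ι → ι → ι → R) :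
    (∑ i, ∑ j, ∑ k, if ({i, j, k} : Finset ι) = {p, q, r} then F i j k else 0) =
      F p q r + (F p r q + (F q p r + (F q r p + (F r p q + F r q p)))) := by
  have fiber : (Finset.univ.filter fun t : ι × ι × ι => ({t.1, t.2.1, t.2.2} : Finset ι) =
      {p, q, r}) = {(p, q, r), (p, r, q), (q, p, r), (q, r, p), (r, p, q), (r, q, p)} := by
    ext ⟨i, j, k⟩
    simpa using triple_eq_triple_iff hpq hpr hqr i j k
  calc _ = ∑ t : ι × ι × ι with ({t.1, t.2.1, t.2.2} : Finset ι) = {p, q, r},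
        F t.1 t.2.1 t.2.2 := by simp only [Finset.sum_filter, Fintype.sum_prod_type]
    _ = _ := by
      rw [fiber]
      repeat rw [Finset.sum_insert (by simp [hpq, hpr, hqr, hpq.symm, hpr.symm, hqr.symm])]
      rw [Finset.sum_singleton]

theorem cMatrix_add_transpose_apply {N : ℕ} {E : Finset (Finset (Fin N))}
    (hE : ∀ e ∈ E, e.card = 3) (x : Bits N) (i j : Fin N) :
    (cMatrix E x + (cMatrix E x)ᵀ) i j =
      ∑ k, if ({i, j, k} : Finset (Fin N)) ∈ E then x k else 0 := by
  rw [← Finset.sum_filter]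
  simp only [cMatrix, Matrix.add_apply, Matrix.transpose_apply, Matrix.of_apply]
  rcases lt_trichotomy i j with hij | rfl | hji
  · simp [hij, hij.not_gt]
  · have no_edge (k : Fin N) : ({i, i, k} : Finset (Fin N)) ∉ E := fun hk => by
      have := Finset.card_le_two (a := i) (b := k)
      have := hE _ hk
      grind
    simp only [lt_irrefl, if_false, add_zero, no_edge, Finset.filter_false, Finset.sum_empty]
  · simp [hji, hji.not_gt, Finset.insert_comm i j]

theorem dotProduct_mulVec_cMatrix {N : ℕ} {E : Finset (Finset (Fin N))}
    (hE : ∀ e ∈ E, e.card = 3) (x a b : Bits N) :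
    ((cMatrix E x + (cMatrix E x)ᵀ) *ᵥ b) ⬝ᵥ a =
      ∑ e ∈ E, ∑ i, ∑ j, ∑ k, if ({i, j, k} : Finset (Fin N)) = e then a i * b j * x k else 0 := by
  simp only [dotProduct, Matrix.mulVec, cMatrix_add_transpose_apply hE, Finset.sum_mul]
  simp only [Finset.sum_comm (s := E), Finset.sum_ite_eq, ite_mul, zero_mul]
  refine Finset.sum_congr rfl fun i _ => Finset.sum_congr rfl fun j _ =>
    Finset.sum_congr rfl fun k _ => if_congr Iff.rfl (by ring) rfl

theorem edgeForm_polarization {N : ℕ} {E : Finset (Finset (Fin N))} (hE : ∀ e ∈ E, e.card = 3)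
    (x a b : Bits N) :
    edgeForm E (a + b + x) + edgeForm E (a + b) + (edgeForm E (0 + x) + edgeForm E 0) =
      edgeForm E (a + x) + edgeForm E a + (edgeForm E (b + x) + edgeForm E b)
        + ((cMatrix E x + (cMatrix E x)ᵀ) *ᵥ b) ⬝ᵥ a := by
  rw [dotProduct_mulVec_cMatrix hE]
  simp only [edgeForm, ← Finset.sum_add_distrib]
  refine Finset.sum_congr rfl fun e he => ?_
  obtain ⟨p, q, r, hpq, hpr, hqr, rfl⟩ := Finset.card_eq_three.mp (hE e he)
  have prod_triple (y : Bits N) : ∏ i ∈ ({p, q, r} : Finset (Fin N)), y i = y p * (y q * y r) := by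
    rw [Finset.prod_insert (by simp [hpq, hpr]), Finset.prod_pair hqr]
  rw [sum_triples_eq_triple hpq hpr hqr]
  simp only [prod_triple, Pi.add_apply, Pi.zero_apply]
  grind

theorem sum_rpow_norm_hypergraphState_expectation {N : ℕ} {α : ℝ} (hα : 0 < α)
    {E : Finset (Finset (Fin N))} (hE : ∀ e ∈ E, e.card = 3) (x : Bits N) :
    ∑ z, ‖star (hypergraphState E) ⬝ᵥ (pauliString x z *ᵥ hypergraphState E)‖ ^ (2 * α) =
      (2 : ℝ) ^ ((1 - α) * twoH E x) := by
  simp only [norm_hypergraphState_expectation]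
  simpa [twoH] using sum_rpow_norm_sum_mul_dotChar signChar_isPrimitive
    (isQuadraticPhase_signChar (edgeForm_polarization hE x)) hα

theorem plMoment_hypergraphState {N : ℕ} {α : ℝ} (hα : 0 < α)
    {E : Finset (Finset (Fin N))} (hE : ∀ e ∈ E, e.card = 3) :
    plMoment α (hypergraphState E) = 1 / 2 ^ N * ∑ x, (2 : ℝ) ^ ((1 - α) * twoH E x) := by
  simp only [plMoment, sum_rpow_norm_hypergraphState_expectation hα hE]

end HypergraphStates

section ChainKernel

open scoped Stream'

theorem card_of_mem_chain {N : ℕ} {e : Finset (Fin N)} (he : e ∈ chain N) : e.card = 3 := by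
  obtain ⟨i, j, k, hj, hk, rfl⟩ := (Finset.mem_filter.mp he).2
  rw [Finset.card_eq_three]
  refine ⟨i, j, k, ?_, ?_, ?_, rfl⟩ <;> rw [ne_eq, Fin.ext_iff] <;> omega

/-- The pairs of vertices that form an edge of the chain with vertex `i`, where vertex `j` is
recorded as `j + 2` so that no subtraction occurs. -/
def linkPairs (i : ℕ) : Finset (ℕ × ℕ) :=
  {(i, i + 1), (i + 1, i), (i + 1, i + 3), (i + 3, i + 1), (i + 3, i + 4), (i + 4, i + 3)}

theorem triple_mem_chain_iff {N : ℕ} (i j k : Fin N) :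
    ({i, j, k} : Finset (Fin N)) ∈ chain N ↔ ((j : ℕ) + 2, (k : ℕ) + 2) ∈ linkPairs i := by
  simp only [chain, linkPairs, Finset.mem_filter, Finset.mem_univ, true_and, Finset.mem_insert,
    Finset.mem_singleton, Prod.mk.injEq]
  constructor
  · rintro ⟨a, b, c, hb, hc, habc⟩
    have hab : a ≠ b := by rw [ne_eq, Fin.ext_iff]; omega
    have hac : a ≠ c := by rw [ne_eq, Fin.ext_iff]; omega
    have hbc : b ≠ c := by rw [ne_eq, Fin.ext_iff]; omega
    rw [triple_eq_triple_iff hab hac hbc] at habc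
    simp only [Finset.mem_insert, Finset.mem_singleton, Prod.mk.injEq, Fin.ext_iff] at habc
    omega
  · rintro (h | h | h | h | h | h)
    · exact ⟨j, k, i, by omega, by omega, by grind⟩
    · exact ⟨k, j, i, by omega, by omega, by grind⟩
    · exact ⟨j, i, k, by omega, by omega, by grind⟩
    · exact ⟨k, i, j, by omega, by omega, by grind⟩
    · exact ⟨i, j, k, by omega, by omega, by grind⟩
    · exact ⟨i, k, j, by omega, by omega, by grind⟩

/-- The extension of a bit string to an infinite sequence by zeros. -/
def extend {N : ℕ} (x : Bits N) : Stream' (ZMod 2) := fun n => if h : n < N then x ⟨n, h⟩ else 0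

theorem extend_vecCons {N : ℕ} (a : ZMod 2) (x : Bits N) :
    extend (Matrix.vecCons a x) = a :: extend x := by
  funext n
  cases n with
  | zero => rfl
  | succ n => simp [extend, Stream'.cons, Matrix.vecCons, Fin.cons]

/-- The extension of a bit string by zeros in both directions; vertex `i` has position `i + 2`. -/
def pad {N : ℕ} (x : Bits N) : Stream' (ZMod 2) := 0 :: 0 :: extend x

theorem pad_get {N : ℕ} (x : Bits N) (q : ℕ) :
    (pad x).get q = ∑ k : Fin N, if (k : ℕ) + 2 = q then x k else 0 := by
  match q with
  | 0 => simp [pad]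
  | 1 => simp [pad]
  | q + 2 =>
    simp only [Nat.add_right_cancel_iff]
    by_cases hq : q < N
    · rw [Finset.sum_eq_single ⟨q, hq⟩ (fun k _ hk => if_neg (by simpa [Fin.ext_iff] using hk))
        (by simp), if_pos rfl]
      exact dif_pos hq
    · rw [Finset.sum_eq_zero fun k _ => if_neg (by omega)]
      exact dif_neg hq

theorem sum_mul_pad {N : ℕ} (x v : Bits N) (S : Finset (ℕ × ℕ)) :
    (∑ j : Fin N, ∑ k : Fin N, if ((j : ℕ) + 2, (k : ℕ) + 2) ∈ S then v j * x k else 0) =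
      ∑ p ∈ S, (pad v).get p.1 * (pad x).get p.2 := by
  simp only [pad_get, Finset.sum_mul_sum]
  rw [Finset.sum_comm]
  simp only [Finset.sum_comm (s := S), ite_zero_mul_ite_zero]
  rw [Finset.sum_comm]
  refine Finset.sum_congr rfl fun j _ => Finset.sum_congr rfl fun k _ => ?_
  rw [← Finset.sum_ite_eq S ((j : ℕ) + 2, (k : ℕ) + 2) fun _ => v j * x k]
  simp only [Prod.ext_iff]

/-- Row `i` of `C(x) + C(x)ᵀ` for the chain, applied to `v`, in terms of the padded sequences `X` of
`x` and `V` of `v`. -/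
def chainRow (X V : Stream' (ZMod 2)) (i : ℕ) : ZMod 2 :=
  ∑ p ∈ linkPairs i, V.get p.1 * X.get p.2

theorem chainRow_eq (X V : Stream' (ZMod 2)) (i : ℕ) :
    chainRow X V i = V.get i * X.get (i + 1) + (V.get (i + 1) * X.get i
      + (V.get (i + 1) * X.get (i + 3) + (V.get (i + 3) * X.get (i + 1)
      + (V.get (i + 3) * X.get (i + 4) + V.get (i + 4) * X.get (i + 3))))) := by
  rw [chainRow, linkPairs]
  repeat rw [Finset.sum_insert (by simp)]
  rw [Finset.sum_singleton]

theorem mulVec_chain_apply {N : ℕ} (x v : Bits N) (i : Fin N) :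
    ((cMatrix (chain N) x + (cMatrix (chain N) x)ᵀ) *ᵥ v) i = chainRow (pad x) (pad v) i := by
  rw [chainRow, ← sum_mul_pad]
  simp only [Matrix.mulVec, dotProduct, cMatrix_add_transpose_apply fun _ => card_of_mem_chain,
    triple_mem_chain_iff, Finset.sum_mul, ite_mul, zero_mul, mul_comm (x _)]

/-- The rows `0, …, N - 1` of the chain on infinitely many vertices annihilate `V`. -/
def Annihilates (N : ℕ) (X V : Stream' (ZMod 2)) : Prop := ∀ i < N, chainRow X V i = 0

instance (N : ℕ) (X V : Stream' (ZMod 2)) : Decidable (Annihilates N X V) := by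
  unfold Annihilates; infer_instance

theorem mulVec_chain_eq_zero_iff {N : ℕ} (x v : Bits N) :
    (cMatrix (chain N) x + (cMatrix (chain N) x)ᵀ) *ᵥ v = 0 ↔ Annihilates N (pad x) (pad v) := by
  simp only [funext_iff, mulVec_chain_apply, Pi.zero_apply, Annihilates, Fin.forall_iff]

theorem annihilates_succ (N : ℕ) (a b : ZMod 2) (X V : Stream' (ZMod 2)) :
    Annihilates (N + 1) (a :: X) (b :: V) ↔
      chainRow (a :: X) (b :: V) 0 = 0 ∧ Annihilates N X V := by
  simp only [Annihilates, Nat.forall_lt_succ_left, chainRow_eq, Nat.add_right_comm _ 1,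
    Stream'.get_succ_cons]

theorem annihilates_congr {N : ℕ} {a b c d a' b' c' d' : ZMod 2} {X V : Stream' (ZMod 2)}
    (h0 : chainRow (a :: b :: X) (c :: d :: V) 0 = chainRow (a' :: b' :: X) (c' :: d' :: V) 0)
    (h1 : chainRow (b :: X) (d :: V) 0 = chainRow (b' :: X) (d' :: V) 0) :
    Annihilates N (a :: b :: X) (c :: d :: V) ↔ Annihilates N (a' :: b' :: X) (c' :: d' :: V) := by
  match N with
  | 0 => simp [Annihilates]
  | 1 => simp [Annihilates, h0]
  | N + 2 => simp only [annihilates_succ, h0, h1]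

theorem annihilates_third_one (n : ℕ) (x₀ x₁ v₀ v₁ : ZMod 2) (Y W : Stream' (ZMod 2)) :
    Annihilates (n + 2) (0 :: 0 :: x₀ :: x₁ :: 1 :: Y) (0 :: 0 :: v₀ :: v₁ :: W) ↔
      v₁ = x₁ * W.get 0 ∧ v₀ = W.get 1 + (Y.get 0 + x₀) * W.get 0 ∧
        Annihilates n (0 :: 0 :: 1 :: Y) (0 :: 0 :: W) := by
  rw [annihilates_succ, annihilates_succ]
  refine and_congr ?_ (and_congr_left' ?_) |>.trans
    (and_congr_right fun _ => and_congr_right fun _ => annihilates_congr ?_ ?_) <;>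
  · simp only [chainRow_eq, Stream'.get_succ_cons, Stream'.get_zero_cons, zero_add]
    grind

theorem annihilates_second_one_third_zero (n : ℕ) (x₀ v₀ v₁ v₂ : ZMod 2) (Y W : Stream' (ZMod 2)) :
    Annihilates (n + 3) (0 :: 0 :: x₀ :: 1 :: 0 :: Y) (0 :: 0 :: v₀ :: v₁ :: v₂ :: W) ↔
      v₂ = 0 ∧ v₀ = Y.get 0 * W.get 1 + Y.get 1 * W.get 0 + W.get 0 + Y.get 0 * v₁ + x₀ * v₁ ∧
        Annihilates n (0 :: 0 :: Y) (0 :: 0 :: W) := by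
  rw [annihilates_succ, annihilates_succ, annihilates_succ]
  refine (and_congr_left' (b := v₂ = 0) ?_).trans (and_congr_right fun hv₂ => ?_)
  · simp only [chainRow_eq, Stream'.get_succ_cons, Stream'.get_zero_cons, zero_add]
    grind
  rw [and_iff_right]
  · refine (and_congr_left' ?_).trans (and_congr_right fun _ => annihilates_congr ?_ ?_) <;>
    · simp only [chainRow_eq, Stream'.get_succ_cons, Stream'.get_zero_cons, zero_add]
      grind
  · simp only [chainRow_eq, Stream'.get_succ_cons, Stream'.get_zero_cons, zero_add]
    grind

theorem annihilates_zero_zero_zero (n : ℕ) (v₀ : ZMod 2) (Y W : Stream' (ZMod 2)) :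
    Annihilates (n + 1) (0 :: 0 :: 0 :: 0 :: 0 :: Y) (0 :: 0 :: v₀ :: W) ↔
      Annihilates n (0 :: 0 :: 0 :: 0 :: Y) (0 :: 0 :: W) := by
  rw [annihilates_succ, and_iff_right]
  · refine annihilates_congr ?_ ?_ <;>
    · simp only [chainRow_eq, Stream'.get_succ_cons, Stream'.get_zero_cons, zero_add]
      grind
  · simp only [chainRow_eq, Stream'.get_succ_cons, Stream'.get_zero_cons, zero_add]
    grind

theorem annihilates_one_zero_zero_one (n : ℕ) (v₀ v₁ : ZMod 2) (Y W : Stream' (ZMod 2)) :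
    Annihilates (n + 2) (0 :: 0 :: 1 :: 0 :: 0 :: 1 :: Y) (0 :: 0 :: v₀ :: v₁ :: W) ↔
      Annihilates n (0 :: 0 :: 0 :: 1 :: Y) (0 :: 0 :: W) := by
  rw [annihilates_succ, annihilates_succ, and_iff_right, and_iff_right]
  · refine annihilates_congr ?_ ?_ <;>
    · simp only [chainRow_eq, Stream'.get_succ_cons, Stream'.get_zero_cons, zero_add]
      grind
  all_goals
    simp only [chainRow_eq, Stream'.get_succ_cons, Stream'.get_zero_cons, zero_add]
    grind

theorem annihilates_one_zero_zero {Y : Stream' (ZMod 2)} (hY : Y.get 0 = 0) (n : ℕ)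
    (v₀ v₁ v₂ : ZMod 2) (W : Stream' (ZMod 2)) :
    Annihilates (n + 3) (0 :: 0 :: 1 :: 0 :: 0 :: Y) (0 :: 0 :: v₀ :: v₁ :: v₂ :: W) ↔
      v₂ = 0 ∧ v₁ = Y.get 1 * W.get 0 ∧ Annihilates n (0 :: 0 :: Y) (0 :: 0 :: W) := by
  rw [annihilates_succ, annihilates_succ, annihilates_succ, and_iff_right]
  · refine and_congr ?_ (and_congr_left' ?_) |>.trans
      (and_congr_right fun _ => and_congr_right fun _ => annihilates_congr ?_ ?_) <;>
    · simp only [chainRow_eq, Stream'.get_succ_cons, Stream'.get_zero_cons, zero_add]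
      grind
  · simp only [chainRow_eq, Stream'.get_succ_cons, Stream'.get_zero_cons, zero_add]
    grind

/-- The number of solutions `v` of `(C(x) + C(x)ᵀ) v = 0` for the chain. -/
def kerCard {N : ℕ} (x : Bits N) : ℕ := ∑ v : Bits N, if Annihilates N (pad x) (pad v) then 1 else 0

theorem two_pow_twoH_mul_kerCard {N : ℕ} (x : Bits N) :
    2 ^ twoH (chain N) x * kerCard x = 2 ^ N := by
  have card_ker : kerCard x =
      Nat.card (cMatrix (chain N) x + (cMatrix (chain N) x)ᵀ).mulVecLin.ker := by
    rw [kerCard, ← Finset.card_filter, ← Fintype.card_subtype, ← Nat.card_eq_fintype_card]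
    exact Nat.card_congr (Equiv.subtypeEquivRight fun v => (mulVec_chain_eq_zero_iff x v).symm)
  simpa [card_ker, twoH] using
    card_pow_rank_mul_card_ker (cMatrix (chain N) x + (cMatrix (chain N) x)ᵀ)

theorem kerCard_pos {N : ℕ} (x : Bits N) : 0 < kerCard x :=
  Nat.pos_of_mul_pos_left ((two_pow_twoH_mul_kerCard x).symm ▸ Nat.two_pow_pos N)

theorem twoH_eq_add_of_kerCard_eq {N n k r : ℕ} {x : Bits N} {y : Bits n} (hN : N = n + k + r)
    (h : kerCard x = 2 ^ k * kerCard y) : twoH (chain N) x = twoH (chain n) y + r := by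
  have count : 2 ^ (twoH (chain N) x + k) * kerCard y =
      2 ^ (twoH (chain n) y + r + k) * kerCard y := by
    calc 2 ^ (twoH (chain N) x + k) * kerCard y = 2 ^ twoH (chain N) x * kerCard x := by
          rw [h, pow_add]; ring
      _ = 2 ^ n * 2 ^ k * 2 ^ r := by rw [two_pow_twoH_mul_kerCard, hN, pow_add, pow_add]
      _ = 2 ^ (twoH (chain n) y + r + k) * kerCard y := by
          rw [← two_pow_twoH_mul_kerCard y]; ring
  have := Nat.pow_right_injective le_rfl (Nat.eq_of_mul_eq_mul_right (kerCard_pos y) count)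
  omega

theorem sum_bits_succ {R : Type*} [AddCommMonoid R] {n : ℕ} (F : Bits (n + 1) → R) :
    ∑ x, F x = ∑ y : Bits n, ∑ a : ZMod 2, F (vecCons a y) := by
  rw [← Fintype.sum_prod_type_right']
  exact (Equiv.sum_comp (Fin.consEquiv fun _ => ZMod 2) F).symm

theorem twoH_third_one {n : ℕ} (x₀ x₁ : ZMod 2) (y : Bits n) :
    twoH (chain (n + 3)) (vecCons x₀ (vecCons x₁ (vecCons 1 y))) =
      twoH (chain (n + 1)) (vecCons 1 y) + 2 := by
  refine twoH_eq_add_of_kerCard_eq (k := 0) (by omega) ?_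
  rw [kerCard, sum_bits_succ, sum_bits_succ]
  simp [kerCard, pad, extend_vecCons, annihilates_third_one, ite_and]

theorem twoH_second_one_third_zero {n : ℕ} (x₀ : ZMod 2) (y : Bits n) :
    twoH (chain (n + 3)) (vecCons x₀ (vecCons 1 (vecCons 0 y))) = twoH (chain n) y + 2 := by
  refine twoH_eq_add_of_kerCard_eq (k := 1) (by omega) ?_
  rw [kerCard, kerCard, Finset.mul_sum, sum_bits_succ, sum_bits_succ, sum_bits_succ]
  simp only [mul_ite, mul_one, mul_zero]
  simp [pad, extend_vecCons, annihilates_second_one_third_zero, ite_and]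

theorem twoH_zero_zero_zero {n : ℕ} (y : Bits n) :
    twoH (chain (n + 3)) (vecCons 0 (vecCons 0 (vecCons 0 y))) =
      twoH (chain (n + 2)) (vecCons 0 (vecCons 0 y)) := by
  refine twoH_eq_add_of_kerCard_eq (k := 1) (r := 0) (by omega) ?_
  rw [kerCard, kerCard, Finset.mul_sum, sum_bits_succ]
  simp [pad, extend_vecCons, annihilates_zero_zero_zero]

theorem twoH_one_zero_zero_one {n : ℕ} (y : Bits n) :
    twoH (chain (n + 4)) (vecCons 1 (vecCons 0 (vecCons 0 (vecCons 1 y)))) =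
      twoH (chain (n + 2)) (vecCons 0 (vecCons 1 y)) := by
  refine twoH_eq_add_of_kerCard_eq (k := 2) (r := 0) (by omega) ?_
  rw [kerCard, kerCard, Finset.mul_sum, sum_bits_succ, sum_bits_succ]
  simp [pad, extend_vecCons, annihilates_one_zero_zero_one]

theorem twoH_one_zero_zero {n : ℕ} {y : Bits n} (hy : (extend y).get 0 = 0) :
    twoH (chain (n + 3)) (vecCons 1 (vecCons 0 (vecCons 0 y))) = twoH (chain n) y + 2 := by
  refine twoH_eq_add_of_kerCard_eq (k := 1) (by omega) ?_
  rw [kerCard, kerCard, Finset.mul_sum, sum_bits_succ, sum_bits_succ, sum_bits_succ]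
  simp only [mul_ite, mul_one, mul_zero]
  simp [pad, extend_vecCons, annihilates_one_zero_zero hy, ite_and]

theorem chain_eq_empty {N : ℕ} (hN : N ≤ 2) : chain N = ∅ :=
  Finset.filter_eq_empty_iff.mpr fun _ _ ⟨i, j, k, _, _, _⟩ => by omega

theorem twoH_empty {N : ℕ} (x : Bits N) : twoH ∅ x = 0 := by
  have : cMatrix ∅ x = 0 := by ext; simp [cMatrix]
  rw [twoH, this, Matrix.transpose_zero, add_zero, Matrix.rank_zero]

end ChainKernel

section Moments

theorem fixedMoment_eq_sum_insert {N : ℕ} (α : ℝ) (E : Finset (Finset (Fin N)))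
    {A : Finset (Fin N)} {i : Fin N} (hi : i ∉ A) (y : Bits N) :
    fixedMoment α E A y =
      (∑ a, fixedMoment α E (insert i A) (Function.update y i a)) / 2 := by
  have hcard : N - A.card = N - (A.card + 1) + 1 := by
    have := Finset.card_lt_univ_of_notMem hi
    rw [Fintype.card_fin] at this
    omega
  have hfix (a : ZMod 2) (x : Bits N) :
      (∀ j ∈ insert i A, x j = Function.update y i a j) ↔ x i = a ∧ ∀ j ∈ A, x j = y j := by
    rw [Finset.forall_mem_insert, Function.update_self]
    refine and_congr_right fun _ => forall₂_congr fun j hj => ?_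
    rw [Function.update_of_ne (ne_of_mem_of_not_mem hj hi)]
  have hsplit (F : Bits N → ℝ) : ∑ a, ∑ x with x i = a ∧ ∀ j ∈ A, x j = y j, F x =
      ∑ x with ∀ j ∈ A, x j = y j, F x := by
    simp only [Finset.sum_filter, ite_and]
    rw [Finset.sum_comm]
    simp only [Finset.sum_ite_eq, Finset.mem_univ, if_true]
  simp only [fixedMoment, hfix, Finset.card_insert_of_notMem hi, hcard, ← Finset.mul_sum, hsplit,
    pow_succ]
  ring

theorem m_eq_add_append {N : ℕ} (α : ℝ) {y : List (ZMod 2)} (hy : y.length < N) :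
    m α N y = (m α N (y ++ [0]) + m α N (y ++ [1])) / 2 := by
  have hA (a : ZMod 2) : (Finset.univ.filter fun i : Fin N => (i : ℕ) < (y ++ [a]).length) =
      insert ⟨y.length, hy⟩ (Finset.univ.filter fun i : Fin N => (i : ℕ) < y.length) := by
    ext i
    simp [Fin.ext_iff, le_iff_eq_or_lt]
  have happend (a : ZMod 2) : (fun i : Fin N => (y ++ [a]).getD i 0) =
      Function.update (fun i : Fin N => y.getD i 0) ⟨y.length, hy⟩ a := by
    funext i
    rcases lt_trichotomy (i : ℕ) y.length with h | h | h
    · rw [Function.update_of_ne (by simpa [Fin.ext_iff] using h.ne), List.getD_append _ _ _ _ h]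
    · obtain rfl : i = ⟨y.length, hy⟩ := Fin.ext h
      simp
    · rw [Function.update_of_ne (by simpa [Fin.ext_iff] using h.ne'),
        List.getD_eq_default _ _ (by simpa using h), List.getD_eq_default _ _ h.le]
  simp only [m, hA, happend]
  rw [fixedMoment_eq_sum_insert α _ (i := ⟨y.length, hy⟩) (by simp)]
  exact congrArg (· / 2) (Fin.sum_univ_two _)

/-- The bit string that starts with `y` and continues with `z`. -/
def prepend {n : ℕ} : (y : List (ZMod 2)) → Bits n → Bits (n + y.length)
  | [], z => z
  | a :: y, z => vecCons a (prepend y z)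

theorem sum_filter_eq_sum_prepend {R : Type*} [AddCommMonoid R] {n : ℕ} (y : List (ZMod 2))
    (F : Bits (n + y.length) → R) :
    ∑ x with ∀ i : Fin (n + y.length), (i : ℕ) < y.length → x i = y.getD i 0, F x =
      ∑ z : Bits n, F (prepend y z) := by
  induction y with
  | nil => simp [prepend]
  | cons a y ih =>
    have hcons (b : ZMod 2) (x : Bits (n + y.length)) :
        (∀ i : Fin (n + y.length + 1), (i : ℕ) < (a :: y).length →
          (vecCons b x : Bits _) i = (a :: y).getD i 0) ↔
        b = a ∧ ∀ i : Fin (n + y.length), (i : ℕ) < y.length → x i = y.getD i 0 := by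
      simp [Fin.forall_fin_succ]
    simp only [Finset.sum_filter] at ih ⊢
    refine (sum_bits_succ (n := n + y.length) _).trans ?_
    simp only [prepend, ← ih fun x => F (vecCons a x)]
    refine Finset.sum_congr rfl fun x _ => ?_
    refine (Finset.sum_congr rfl fun b _ => if_congr (hcons b x) rfl rfl).trans ?_
    simp only [ite_and, Finset.sum_ite_eq', Finset.mem_univ, if_true]

theorem m_add_length (α : ℝ) (n : ℕ) (y : List (ZMod 2)) : m α (n + y.length) y =
    1 / 2 ^ n * ∑ z : Bits n, (2 : ℝ) ^ ((1 - α) * twoH (chain (n + y.length)) (prepend y z)) := by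
  rw [← sum_filter_eq_sum_prepend y fun x => (2 : ℝ) ^ ((1 - α) * twoH (chain (n + y.length)) x)]
  simp only [m, fixedMoment, Fin.card_filter_val_lt, Nat.min_eq_right (Nat.le_add_left _ _),
    Nat.add_sub_cancel, Finset.mem_filter, Finset.mem_univ, true_and]

theorem m_eq_pow_mul_of_twoH_eq_add (α : ℝ) {n r : ℕ} {y y' : List (ZMod 2)}
    (h : ∀ z : Bits n, twoH (chain (n + y.length)) (prepend y z) =
      twoH (chain (n + y'.length)) (prepend y' z) + 2 * r) :
    m α (n + y.length) y = β α ^ r * m α (n + y'.length) y' := by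
  have hβ (z : Bits n) :
      (2 : ℝ) ^ ((1 - α) * twoH (chain (n + y.length)) (prepend y z)) =
        β α ^ r * (2 : ℝ) ^ ((1 - α) * twoH (chain (n + y'.length)) (prepend y' z)) := by
    rw [β, ← Real.rpow_mul_natCast zero_le_two, ← Real.rpow_add two_pos, h]
    push_cast
    ring_nf
  simp only [m_add_length, hβ, ← Finset.mul_sum]
  ring

theorem m_zero_zero_zero (α : ℝ) (n : ℕ) : m α (n + 3) [0, 0, 0] = m α (n + 2) [0, 0] := by
  simpa using m_eq_pow_mul_of_twoH_eq_add α (r := 0) (y := [0, 0, 0]) (y' := [0, 0])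
    twoH_zero_zero_zero (n := n)

theorem m_third_one (α : ℝ) (n : ℕ) (x₀ x₁ : ZMod 2) :
    m α (n + 3) [x₀, x₁, 1] = β α * m α (n + 1) [1] := by
  simpa using m_eq_pow_mul_of_twoH_eq_add α (r := 1) (y := [x₀, x₁, 1]) (y' := [1])
    (twoH_third_one (n := n) x₀ x₁)

theorem m_second_one_third_zero (α : ℝ) (n : ℕ) (x₀ : ZMod 2) :
    m α (n + 3) [x₀, 1, 0] = β α * m α n [] := by
  simpa using m_eq_pow_mul_of_twoH_eq_add α (r := 1) (y := [x₀, 1, 0]) (y' := [])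
    (twoH_second_one_third_zero (n := n) x₀)

theorem m_one_zero_zero_one (α : ℝ) (n : ℕ) : m α (n + 4) [1, 0, 0, 1] = m α (n + 2) [0, 1] := by
  simpa using m_eq_pow_mul_of_twoH_eq_add α (r := 0) (y := [1, 0, 0, 1]) (y' := [0, 1])
    (twoH_one_zero_zero_one (n := n))

theorem m_one_zero_zero_zero (α : ℝ) (n : ℕ) :
    m α (n + 4) [1, 0, 0, 0] = β α * m α (n + 1) [0] := by
  simpa using m_eq_pow_mul_of_twoH_eq_add α (r := 1) (y := [1, 0, 0, 0]) (y' := [0])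
    fun z : Bits n => twoH_one_zero_zero (y := vecCons 0 z) rfl

theorem m_nil_of_le_two (α : ℝ) {N : ℕ} (hN : N ≤ 2) : m α N [] = 1 := by
  simp [m, fixedMoment, chain_eq_empty hN, twoH_empty]

theorem m_add_length_of_le_two (α : ℝ) {n : ℕ} {y : List (ZMod 2)} (h : n + y.length ≤ 2) :
    m α (n + y.length) y = 1 := by
  simp [m_add_length, chain_eq_empty h, twoH_empty]

theorem m_nil_succ (α : ℝ) (n : ℕ) :
    m α (n + 1) [] = (m α (n + 1) [0] + m α (n + 1) [1]) / 2 :=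
  m_eq_add_append α (by simp)

theorem m_singleton_succ (α : ℝ) (n : ℕ) (x₀ : ZMod 2) :
    m α (n + 2) [x₀] = (m α (n + 2) [x₀, 0] + m α (n + 2) [x₀, 1]) / 2 :=
  m_eq_add_append α (by simp)

theorem m_nil_eq (α : ℝ) (n : ℕ) : m α (n + 2) [] =
    (m α (n + 2) [0, 0] + m α (n + 2) [0, 1]) / 4 + m α (n + 2) [1] / 2 := by
  rw [m_nil_succ, m_singleton_succ α n 0]
  ring

theorem m_zero_zero (α : ℝ) (n : ℕ) :
    m α (n + 3) [0, 0] = m α (n + 2) [0, 0] / 2 + β α / 2 * m α (n + 1) [1] := by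
  rw [m_eq_add_append α (by simp)]
  simp only [List.cons_append, List.nil_append, m_zero_zero_zero, m_third_one]
  ring

theorem m_second_one (α : ℝ) (n : ℕ) (x₀ : ZMod 2) :
    m α (n + 3) [x₀, 1] = β α / 2 * m α (n + 1) [1] + β α / 2 * m α n [] := by
  rw [m_eq_add_append α (by simp)]
  simp only [List.cons_append, List.nil_append, m_second_one_third_zero, m_third_one]
  ring

theorem m_one_zero_zero (α : ℝ) (n : ℕ) :
    m α (n + 4) [1, 0, 0] = (β α * m α (n + 1) [0] + m α (n + 2) [0, 1]) / 2 := by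
  rw [m_eq_add_append α (by simp)]
  simp only [List.cons_append, List.nil_append, m_one_zero_zero_zero, m_one_zero_zero_one]

theorem m_one (α : ℝ) (n : ℕ) :
    m α (n + 3) [1] = m α (n + 3) [1, 0, 0] / 4 + β α / 2 * m α (n + 1) [1]
      + β α / 4 * m α n [] := by
  rw [m_singleton_succ, m_second_one, m_eq_add_append α (y := [1, 0]) (by simp)]
  simp only [List.cons_append, List.nil_append, m_third_one]
  ring

theorem m_recursion (α : ℝ) (n : ℕ) :
    m α (n + 4) [0, 0] = 1 / 4 * m α (n + 2) [0, 0] + β α / 2 * m α (n + 2) [1]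
      + β α / 4 * m α (n + 1) [1] ∧
    m α (n + 4) [1] = β α / 2 * m α (n + 2) [1] + 1 / 8 * m α (n + 2) [0, 1]
      + β α / 4 * m α (n + 1) [0] + β α / 8 * m α (n + 1) [1] ∧
    m α (n + 4) [0, 1] = β α / 2 * m α (n + 2) [1] + β α / 2 * m α (n + 1) [] := by
  refine ⟨?_, ?_, m_second_one α (n + 1) 0⟩
  · rw [m_zero_zero α (n + 1), m_zero_zero α n]
    ring
  · rw [m_one α (n + 1), m_one_zero_zero, m_nil_succ]
    ring

theorem m_two_pair (α : ℝ) (y₀ y₁ : ZMod 2) : m α 2 [y₀, y₁] = 1 :=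
  m_add_length_of_le_two α (n := 0) (y := [y₀, y₁]) le_rfl

theorem m_two_singleton (α : ℝ) (y₀ : ZMod 2) : m α 2 [y₀] = 1 :=
  m_add_length_of_le_two α (n := 1) (y := [y₀]) le_rfl

theorem m_one_singleton (α : ℝ) (y₀ : ZMod 2) : m α 1 [y₀] = 1 :=
  m_add_length_of_le_two α (n := 0) (y := [y₀]) one_le_two

theorem m_three_zero_zero (α : ℝ) : m α 3 [0, 0] = (1 + β α) / 2 := by
  rw [m_zero_zero α 0, m_two_pair, m_one_singleton]
  ring

theorem m_three_zero_one (α : ℝ) : m α 3 [0, 1] = β α := by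
  rw [m_second_one α 0, m_one_singleton, m_nil_of_le_two α zero_le_two]
  ring

theorem m_three_one_zero_zero (α : ℝ) : m α 3 [1, 0, 0] = β α * m α 0 [] := by
  simpa using m_eq_pow_mul_of_twoH_eq_add α (r := 1) (y := [1, 0, 0]) (y' := [])
    fun z : Bits 0 => twoH_one_zero_zero (y := z) rfl

theorem m_three_one (α : ℝ) : m α 3 [1] = β α := by
  rw [m_one α 0, m_three_one_zero_zero, m_one_singleton, m_nil_of_le_two α zero_le_two]
  ring

theorem m_four (α : ℝ) :
    m α 4 [0, 0] = (1 + 3 * β α) / 4 ∧ m α 4 [0, 1] = β α ∧ m α 4 [1] = (1 + 7 * β α) / 8 := by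
  obtain ⟨h_zero_zero, h_one, h_zero_one⟩ := m_recursion α 0
  rw [h_zero_zero, h_zero_one, h_one, m_two_pair, m_two_pair, m_two_singleton, m_one_singleton,
    m_one_singleton, m_nil_of_le_two α (N := 0 + 1) one_le_two]
  refine ⟨?_, ?_, ?_⟩ <;> ring

end Moments

section TransferMatrix

theorem transfer_mulVec (α : ℝ) (u v : Fin 3 → ℝ) (w : Fin 2 → ℝ) :
    transfer α *ᵥ Sum.elim u (Sum.elim v w) =
      Sum.elim (matA α *ᵥ v + matB α *ᵥ w) (Sum.elim u (matC *ᵥ v)) := by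
  rw [transfer, Matrix.fromBlocks_mulVec]
  simp only [Sum.elim_comp_inl, Sum.elim_comp_inr, Matrix.zero_mulVec, zero_add,
    Matrix.fromCols_mulVec_sumElim, Matrix.fromRows_mulVec, Matrix.fromBlocks_mulVec,
    Matrix.one_mulVec]
  ext (i | i | i) <;> simp

theorem vec3_recursion (α : ℝ) (n : ℕ) :
    vec3 α (n + 4) = matA α *ᵥ vec3 α (n + 2) + matB α *ᵥ vec2 α (n + 1) := by
  obtain ⟨h_zero_zero, h_one, h_zero_one⟩ := m_recursion α n
  rw [m_nil_succ] at h_zero_one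
  funext i
  fin_cases i <;> simp [vec3, vec2, matA, matB, h_zero_zero, h_zero_one, h_one] <;> ring

theorem vec2_eq_matC_mulVec (α : ℝ) (n : ℕ) : vec2 α (n + 2) = matC *ᵥ vec3 α (n + 2) := by
  funext i
  fin_cases i <;> simp [vec3, vec2, matC, m_singleton_succ α n 0]
  ring

theorem vecM_recursion (α : ℝ) (n : ℕ) : vecM α (n + 4) = transfer α *ᵥ vecM α (n + 3) := by
  simp only [vecM, Nat.reduceSubDiff, transfer_mulVec, ← vec3_recursion,
    ← vec2_eq_matC_mulVec]

theorem vecM_three (α : ℝ) : vecM α 3 = initM α := by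
  simp [vecM, initM, vec3, vec2, m_three_zero_zero, m_three_zero_one, m_three_one, m_two_pair,
    m_two_singleton, m_one_singleton]

theorem vecM_eq_transfer_pow_mulVec (α : ℝ) (n : ℕ) :
    vecM α (n + 3) = transfer α ^ n *ᵥ initM α := by
  induction n with
  | zero => rw [pow_zero, Matrix.one_mulVec, vecM_three]
  | succ n ih => rw [vecM_recursion, ih, Matrix.mulVec_mulVec, pow_succ']

theorem chainPL_eq_m {α : ℝ} (hα : 0 < α) (N : ℕ) : chainPL α N = m α N [] := by
  simp [chainPL, plMoment_hypergraphState hα fun _ => card_of_mem_chain, m, fixedMoment]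

theorem chainPL_eq_total {α : ℝ} (hα : 0 < α) (n : ℕ) :
    chainPL α (n + 3) = total (transfer α ^ n *ᵥ initM α) := by
  rw [chainPL_eq_m hα, m_nil_eq α (n + 1), ← vecM_eq_transfer_pow_mulVec]
  rfl

end TransferMatrix

end PauliLiouville

end

theorem mainTheorem3 (α : ℝ) :
    -- the three recursion relations
    (∀ N : ℕ, 4 ≤ N →
      Hypergraph.m α N [0, 0] = 1 / 4 * Hypergraph.m α (N - 2) [0, 0]
        + Hypergraph.β α / 2 * Hypergraph.m α (N - 2) [1]
        + Hypergraph.β α / 4 * Hypergraph.m α (N - 3) [1] ∧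
      Hypergraph.m α N [1] = Hypergraph.β α / 2 * Hypergraph.m α (N - 2) [1]
        + 1 / 8 * Hypergraph.m α (N - 2) [0, 1]
        + Hypergraph.β α / 4 * Hypergraph.m α (N - 3) [0]
        + Hypergraph.β α / 8 * Hypergraph.m α (N - 3) [1] ∧
      Hypergraph.m α N [0, 1] = Hypergraph.β α / 2 * Hypergraph.m α (N - 2) [1]
        + Hypergraph.β α / 2 * Hypergraph.m α (N - 3) []) ∧
    -- their matrix forms
    (∀ N : ℕ, 4 ≤ N →
      Hypergraph.vec3 α N = (Hypergraph.matA α).mulVec (Hypergraph.vec3 α (N - 2))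
        + (Hypergraph.matB α).mulVec (Hypergraph.vec2 α (N - 3)) ∧
      Hypergraph.vecM α N = (Hypergraph.transfer α).mulVec (Hypergraph.vecM α (N - 1))) ∧
    -- the initial values
    (Hypergraph.m α 3 [0, 0] = (1 + Hypergraph.β α) / 2 ∧
      Hypergraph.m α 3 [0, 1] = Hypergraph.β α ∧
      Hypergraph.m α 3 [1] = Hypergraph.β α ∧
      Hypergraph.m α 4 [0, 0] = (1 + 3 * Hypergraph.β α) / 4 ∧
      Hypergraph.m α 4 [0, 1] = Hypergraph.β α ∧
      Hypergraph.m α 4 [1] = (1 + 7 * Hypergraph.β α) / 8 ∧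
      (∀ y₀ y₁ : ZMod 2, Hypergraph.m α 2 [y₀, y₁] = 1) ∧
      (∀ y₀ : ZMod 2, Hypergraph.m α 2 [y₀] = 1) ∧
      (∀ y₀ : ZMod 2, Hypergraph.m α 1 [y₀] = 1)) ∧
    -- the full moment in terms of the partially fixed ones
    (∀ N : ℕ, 2 ≤ N →
      Hypergraph.m α N [] = (Hypergraph.m α N [0, 0] + Hypergraph.m α N [0, 1]) / 4
        + Hypergraph.m α N [1] / 2) ∧
    -- the solution of the recursion
    (∀ N : ℕ, 3 ≤ N →
      Hypergraph.vecM α N = (Hypergraph.transfer α ^ (N - 3)).mulVec (Hypergraph.initM α)) ∧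
    -- the Pauli-Liouville moment of the hypergraph state, exactly, for all `N`
    (0 < α →
      (∀ N : ℕ, Hypergraph.chainPL α N = Hypergraph.m α N []) ∧
      (∀ N : ℕ, N ≤ 2 → Hypergraph.chainPL α N = 1) ∧
      (∀ N : ℕ, 3 ≤ N → Hypergraph.chainPL α N =
        Hypergraph.total ((Hypergraph.transfer α ^ (N - 3)).mulVec (Hypergraph.initM α)))) := by
  open Hypergraph PauliLiouville in
  refine ⟨fun N hN => ?_, fun N hN => ?_, ?_, fun N hN => ?_, fun N hN => ?_,
    fun hα => ⟨chainPL_eq_m hα, fun N hN => ?_, fun N hN => ?_⟩⟩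
  · obtain ⟨n, rfl⟩ := Nat.exists_eq_add_of_le' hN
    exact m_recursion α n
  · obtain ⟨n, rfl⟩ := Nat.exists_eq_add_of_le' hN
    exact ⟨vec3_recursion α n, vecM_recursion α n⟩
  · exact ⟨m_three_zero_zero α, m_three_zero_one α, m_three_one α, (m_four α).1, (m_four α).2.1,
      (m_four α).2.2, m_two_pair α, m_two_singleton α, m_one_singleton α⟩
  · obtain ⟨n, rfl⟩ := Nat.exists_eq_add_of_le' hN
    exact m_nil_eq α n
  · obtain ⟨n, rfl⟩ := Nat.exists_eq_add_of_le' hN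
    exact vecM_eq_transfer_pow_mulVec α n
  · rw [chainPL_eq_m hα, m_nil_of_le_two α hN]
  · obtain ⟨n, rfl⟩ := Nat.exists_eq_add_of_le' hN
    exact chainPL_eq_total hα n
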